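/- For complex $a$, $q$ with $|q|<1$ and $m\ge 0$ put $(a;q)_m=\prod_{j=0}^{m-1}(1-aq^j)$, $(a;q)_\infty=\prod_{j=0}^{\infty}(1-aq^j)$ and $(a_1,a_2,a_3;q)_\infty=(a_1;q)_\infty(a_2;q)_\infty(a_3;q)_\infty$. Then for every complex $q$ with $|q|<1$ the following four identities hold (with $0^0=1$ when $q=0$), all the double series, over integers $n,r\ge 0$, being absolutely convergent: $$\sum_{n,r\ge 0}\frac{(-1)^{n+r}q^{6n^2+8nr+5r^2+4n+4r}}{(-q^2;q^2)_{2n+2r+1}(q^2;q^2)_r(-q;q)_{2r+1}(q^4;q^4)_n}=\frac{(q,q^8,q^9;q^9)_\infty}{(q^4;q^4)_\infty},$$ $$\sum_{n,r\ge 0}\frac{(-1)^{n+r}q^{6n^2+8nr+5r^2+4n+2r}}{(-q^2;q^2)_{2n+2r+1}(q^2;q^2)_r(-q;q)_{2r}(q^4;q^4)_n}=\frac{(q^2,q^7,q^9;q^9)_\infty}{(q^4;q^4)_\infty},$$ $$\sum_{n,r\ge 0}\frac{(-1)^{n+r}q^{6n^2+8nr+5r^2-2r}}{(-q^2;q^2)_{2n+2r}(q^2;q^2)_r(-q;q)_{2r}(q^4;q^4)_n}=\frac{(q^3;q^3)_\infty}{(q^4;q^4)_\infty},$$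 $$\sum_{n,r\ge 0}\frac{(-1)^{n+r}q^{6n^2+8nr+5r^2}}{(-q^2;q^2)_{2n+2r}(q^2;q^2)_r(-q;q)_{2r}(q^4;q^4)_n}=\frac{(q^4,q^5,q^9;q^9)_\infty}{(q^4;q^4)_\infty}.$$ -/

import Mathlib

/-- The finite `q`-shifted factorial `(a; q)_m = ∏_{j=0}^{m-1} (1 - a q^j)`. -/
noncomputable def qPoch (a q : ℂ) (m : ℕ) : ℂ :=
  ∏ j ∈ Finset.range m, (1 - a * q ^ j)

/-- The infinite `q`-shifted factorial `(a; q)_∞ = ∏_{j=0}^∞ (1 - a q^j)`, meaningful for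
`‖q‖ < 1`, where the product converges by `multipliable_qPochInf`. -/
noncomputable def qPochInf (a q : ℂ) : ℂ :=
  ∏' j : ℕ, (1 - a * q ^ j)

/-- `(a, b, c; q)_∞ = (a; q)_∞ (b; q)_∞ (c; q)_∞`. -/
noncomputable def qPochInf₃ (a b c q : ℂ) : ℂ :=
  qPochInf a q * qPochInf b q * qPochInf c q

/-- For `‖q‖ < 1` the infinite product defining `(a; q)_∞` converges. -/
theorem multipliable_qPochInf (a q : ℂ) (hq : ‖q‖ < 1) :
    Multipliable fun j : ℕ => 1 - a * q ^ j := by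
  have h : Summable fun j : ℕ => ‖-(a * q ^ j)‖ := by
    simpa [norm_mul, norm_pow] using
      (summable_geometric_of_lt_one (norm_nonneg q) hq).mul_left ‖a‖
  simpa [sub_eq_add_neg] using multipliable_one_add_of_summable h

/-! In bilateral form a Bailey pair relative to `a = q ^ s` is a family
`β n = ∑ₖ α k / ((q; q)_{n - k} (q; q)_{n + k + s})`, summed over all integers `k`. Two summations
act on such pairs while leaving `α` under control: the change of base `q → q²`, which keeps `α`, and
Bailey's lemma, which multiplies `α k` by `q ^ (k² + s k)`. Both are cases of the single
`q`-Chu–Vandermonde sum, with parameter `-1` and, after a limit, `q ^ (2 k + s)`.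

Start from `α k = (-z) ^ k q ^ (k (k - 1) / 2)`, whose partner `β` is given by the finite triple
product. Two changes of base followed by Bailey's lemma in base `q⁴` turn `∑ₖ α k` into a theta
series in base `q⁹`, which the triple product identity evaluates; the other side is a double series
in the inner `β`, transformed once. For `z = 1` and `z = q⁻¹` the partner `β` vanishes beyond the
first one or two terms, so this transform is a single product. -/

open Filter Topology
open Finset.HasAntidiagonal (antidiagonal mem_antidiagonal)

/-! ### Shifted factorials -/

section

variable {a q : ℂ}

theorem qPoch_zero (a q : ℂ) : qPoch a q 0 = 1 := Finset.prod_range_zero _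

theorem qPoch_succ (a q : ℂ) (n : ℕ) : qPoch a q (n + 1) = qPoch a q n * (1 - a * q ^ n) :=
  Finset.prod_range_succ _ _

theorem qPoch_add (a q : ℂ) (m n : ℕ) :
    qPoch a q (m + n) = qPoch a q m * qPoch (a * q ^ m) q n := by
  simp only [qPoch, Finset.prod_range_add, pow_add, mul_assoc]

theorem qPoch_mul_qPoch_neg (q : ℂ) (n : ℕ) :
    qPoch q q n * qPoch (-q) q n = qPoch (q ^ 2) (q ^ 2) n := by
  simp only [qPoch, ← Finset.prod_mul_distrib]
  exact Finset.prod_congr rfl fun j _ => by ring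

theorem qPoch_three_mul (q : ℂ) (n : ℕ) :
    qPoch q q (3 * n) = qPoch q (q ^ 3) n * qPoch (q ^ 2) (q ^ 3) n * qPoch (q ^ 3) (q ^ 3) n := by
  induction n with
  | zero => simp [qPoch_zero]
  | succ n ih =>
    rw [show 3 * (n + 1) = 3 * n + 1 + 1 + 1 by ring]
    simp only [qPoch_succ, ih]
    ring

theorem qPoch_one_succ (q : ℂ) (n : ℕ) : qPoch 1 q (n + 1) = 0 :=
  Finset.prod_eq_zero (i := 0) (by simp) (by simp)

theorem qPoch_inv_add_two (hq0 : q ≠ 0) (n : ℕ) : qPoch q⁻¹ q (n + 2) = 0 :=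
  Finset.prod_eq_zero (i := 1) (by simp) (by simp [hq0])

theorem norm_pow_lt_one (hq : ‖q‖ < 1) {n : ℕ} (hn : n ≠ 0) : ‖q ^ n‖ < 1 := by
  rw [norm_pow]
  exact pow_lt_one₀ (norm_nonneg q) hq hn

theorem one_sub_mul_pow_ne_zero (ha : ‖a‖ < 1) (hq : ‖q‖ < 1) (n : ℕ) : 1 - a * q ^ n ≠ 0 := by
  have hlt : ‖a * q ^ n‖ < 1 := by
    rw [norm_mul, norm_pow]
    exact mul_lt_one_of_nonneg_of_lt_one_left (norm_nonneg a) ha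
      (pow_le_one₀ (norm_nonneg q) hq.le)
  exact sub_ne_zero.mpr fun h => by simp [← h] at hlt

theorem one_sub_pow_ne_zero (hq : ‖q‖ < 1) {n : ℕ} (hn : n ≠ 0) : 1 - q ^ n ≠ 0 := by
  simpa using one_sub_mul_pow_ne_zero (norm_pow_lt_one hq hn) hq 0

theorem qPoch_ne_zero (ha : ∀ n, 1 - a * q ^ n ≠ 0) (n : ℕ) : qPoch a q n ≠ 0 :=
  Finset.prod_ne_zero_iff.mpr fun j _ => ha j

theorem qPochInf_ne_zero (hq : ‖q‖ < 1) (ha : ∀ n, 1 - a * q ^ n ≠ 0) : qPochInf a q ≠ 0 := by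
  have hsum : Summable fun j : ℕ => ‖-(a * q ^ j)‖ := by
    simpa only [norm_neg, norm_mul, norm_pow] using
      (summable_geometric_of_lt_one (norm_nonneg q) hq).mul_left ‖a‖
  simpa only [qPochInf, sub_eq_add_neg] using
    tprod_one_add_ne_zero_of_summable (by simpa only [sub_eq_add_neg] using ha) hsum

theorem qPochInf_self_ne_zero (hq : ‖q‖ < 1) : qPochInf q q ≠ 0 :=
  qPochInf_ne_zero hq (one_sub_mul_pow_ne_zero hq hq)

theorem tendsto_qPoch (a : ℂ) (hq : ‖q‖ < 1) :
    Tendsto (qPoch a q) atTop (𝓝 (qPochInf a q)) :=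
  (multipliable_qPochInf a q hq).hasProd.tendsto_prod_nat

theorem exists_norm_le_of_tendsto {E : Type*} [SeminormedAddCommGroup E] {u : ℕ → E} {l : E}
    (hu : Tendsto u atTop (𝓝 l)) : ∃ C, ∀ n, ‖u n‖ ≤ C := by
  obtain ⟨C, hC⟩ := hu.norm.bddAbove_range
  exact ⟨C, fun n => hC ⟨n, rfl⟩⟩

theorem exists_norm_inv_qPoch_le (ha : ‖a‖ < 1) (hq : ‖q‖ < 1) :
    ∃ C, ∀ n, ‖(qPoch a q n)⁻¹‖ ≤ C :=
  exists_norm_le_of_tendsto <|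
    (tendsto_qPoch a hq).inv₀ (qPochInf_ne_zero hq (one_sub_mul_pow_ne_zero ha hq))

theorem qPochInf₃_swap (a b c q : ℂ) : qPochInf₃ a b c q = qPochInf₃ b a c q := by
  rw [qPochInf₃, mul_comm (qPochInf a q), ← qPochInf₃]

theorem qPochInf_eq_qPochInf₃_pow_three (hq : ‖q‖ < 1) :
    qPochInf q q = qPochInf₃ q (q ^ 2) (q ^ 3) (q ^ 3) := by
  have hq3 : ‖q ^ 3‖ < 1 := norm_pow_lt_one hq three_ne_zero
  have hleft : Tendsto (fun n : ℕ => qPoch q q (3 * n)) atTop (𝓝 (qPochInf q q)) :=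
    (tendsto_qPoch q hq).comp (tendsto_id.const_mul_atTop' three_pos)
  refine tendsto_nhds_unique hleft (Tendsto.congr (fun n => (qPoch_three_mul q n).symm) ?_)
  exact ((tendsto_qPoch _ hq3).mul (tendsto_qPoch _ hq3)).mul (tendsto_qPoch _ hq3)

end

section

variable {q : ℂ}

/-- The reciprocal `1 / (q; q)_n` of the `q`-factorial, extended by zero to negative `n`, so that
the sums over Bailey pairs need no explicit range of summation. -/
noncomputable def invQFac (q : ℂ) (n : ℤ) : ℂ :=
  if n < 0 then 0 else (qPoch q q n.toNat)⁻¹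

theorem invQFac_of_neg (q : ℂ) {n : ℤ} (hn : n < 0) : invQFac q n = 0 := if_pos hn

theorem invQFac_natCast (q : ℂ) (n : ℕ) : invQFac q n = (qPoch q q n)⁻¹ := by
  simp [invQFac]

theorem invQFac_zero (q : ℂ) : invQFac q 0 = 1 := by
  simpa [qPoch_zero] using invQFac_natCast q 0

theorem invQFac_sub_one (hq : ‖q‖ < 1) (n : ℤ) :
    invQFac q (n - 1) = (1 - q ^ n) * invQFac q n := by
  rcases lt_trichotomy n 0 with hn | rfl | hn
  · rw [invQFac_of_neg q hn, invQFac_of_neg q (by lia), mul_zero]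
  · rw [invQFac_of_neg q (by lia), zpow_zero, sub_self, zero_mul]
  · obtain ⟨m, rfl⟩ : ∃ m : ℕ, n = (m + 1 : ℕ) := ⟨(n - 1).toNat, by lia⟩
    have hfactor := one_sub_mul_pow_ne_zero hq hq m
    rw [Nat.cast_succ, add_sub_cancel_right, ← Nat.cast_succ, invQFac_natCast, invQFac_natCast,
      qPoch_succ, zpow_natCast, pow_succ', mul_inv_rev, mul_inv_cancel_left₀ hfactor]

theorem invQFac_eq_mul_invQFac_add_one (hq : ‖q‖ < 1) (n : ℤ) :
    invQFac q n = (1 - q ^ (n + 1)) * invQFac q (n + 1) := by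
  rw [← invQFac_sub_one hq, add_sub_cancel_right]

theorem invQFac_natCast_eq_mul_succ (hq : ‖q‖ < 1) (n : ℕ) :
    invQFac q n = (1 - q ^ (n + 1)) * invQFac q (n + 1) := by
  exact_mod_cast invQFac_eq_mul_invQFac_add_one hq n

theorem invQFac_natCast_add (q : ℂ) (m n : ℕ) :
    invQFac q (m + n) = invQFac q m * (qPoch (q ^ m * q) q n)⁻¹ := by
  rw [← Nat.cast_add, invQFac_natCast, invQFac_natCast, qPoch_add, mul_inv, mul_comm q]

theorem qPoch_neg_mul_invQFac_sq (hq : ‖q‖ < 1) (n : ℕ) :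
    qPoch (-q) q n * invQFac (q ^ 2) n = invQFac q n := by
  have hne : qPoch (-q) q n ≠ 0 :=
    qPoch_ne_zero (one_sub_mul_pow_ne_zero (by rwa [norm_neg]) hq) n
  rw [invQFac_natCast, invQFac_natCast, ← qPoch_mul_qPoch_neg, mul_inv_rev,
    mul_inv_cancel_left₀ hne]

theorem tendsto_invQFac (hq : ‖q‖ < 1) {ι : Type*} {l : Filter ι} {f : ι → ℤ}
    (hf : Tendsto f l atTop) : Tendsto (fun i => invQFac q (f i)) l (𝓝 (qPochInf q q)⁻¹) := by
  have htoNat : Tendsto (fun i => (f i).toNat) l atTop := by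
    refine tendsto_atTop.mpr fun b => ?_
    filter_upwards [tendsto_atTop.mp hf b] with i hi
    lia
  refine (((tendsto_qPoch q hq).inv₀ (qPochInf_self_ne_zero hq)).comp htoNat).congr' ?_
  filter_upwards [tendsto_atTop.mp hf 0] with i hi
  simp [invQFac, not_lt.mpr hi]

theorem tendsto_invQFac_natCast_add (hq : ‖q‖ < 1) (m : ℤ) :
    Tendsto (fun n : ℕ => invQFac q (n + m)) atTop (𝓝 (qPochInf q q)⁻¹) :=
  tendsto_invQFac hq (tendsto_atTop_add_const_right _ m tendsto_natCast_atTop_atTop)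

theorem tendsto_invQFac_natCast_sub (hq : ‖q‖ < 1) (m : ℤ) :
    Tendsto (fun n : ℕ => invQFac q (n - m)) atTop (𝓝 (qPochInf q q)⁻¹) :=
  tendsto_invQFac_natCast_add hq (-m)

theorem exists_norm_invQFac_le (hq : ‖q‖ < 1) : ∃ C, ∀ n, ‖invQFac q n‖ ≤ C := by
  obtain ⟨C, hC⟩ := exists_norm_inv_qPoch_le hq hq
  refine ⟨C, fun n => ?_⟩
  rcases lt_or_ge n 0 with hn | hn
  · rw [invQFac_of_neg q hn, norm_zero]
    exact (norm_nonneg _).trans (hC 0)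
  · obtain ⟨m, rfl⟩ := Int.eq_ofNat_of_zero_le hn
    rw [invQFac_natCast]
    exact hC m

end

/-! ### The `q`-Chu–Vandermonde sum -/

section

variable {a q : ℂ}

/-- The summand of the `q`-Chu–Vandermonde sum; as a basic hypergeometric term it is
`1 / ((q; q)_M (q; q)_N)` times the `j`-th term of
`₂φ₁(q^{-M}, q^{-N}; a q; q, a q^{M + N + 1})`. -/
noncomputable def qVandermondeTerm (a q : ℂ) (M N j : ℕ) : ℂ :=
  a ^ j * q ^ j ^ 2 * ((qPoch (a * q) q j)⁻¹ * invQFac q j)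
    * (invQFac q (M - j) * invQFac q (N - j))

theorem qVandermondeTerm_of_lt (a q : ℂ) {M N j : ℕ} (hj : min M N < j) :
    qVandermondeTerm a q M N j = 0 := by
  rcases min_lt_iff.mp hj with hM | hN
  · rw [qVandermondeTerm, invQFac_of_neg q (n := M - j) (by lia), zero_mul, mul_zero]
  · rw [qVandermondeTerm, invQFac_of_neg q (n := N - j) (by lia), mul_zero, mul_zero]

/-- The Wilf–Zeilberger certificate of `qVandermondeTerm` for the recurrence in `M`. -/
noncomputable def qVandermondeCertificate (a q : ℂ) (M N j : ℕ) : ℂ :=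
  -(q ^ (M + 1 - j : ℤ) * (1 - q ^ j) * (1 - a * q ^ j) * qVandermondeTerm a q (M + 1) N j)

theorem qVandermondeTerm_recurrence (hq : ‖q‖ < 1) (hq0 : q ≠ 0)
    (ha : ∀ n, 1 - a * q * q ^ n ≠ 0) (M N j : ℕ) :
    (1 - q ^ (M + 1)) * (1 - a * q ^ (M + 1)) * qVandermondeTerm a q (M + 1) N j
        - (1 - a * q ^ (M + N + 1)) * qVandermondeTerm a q M N j
      = qVandermondeCertificate a q M N (j + 1) - qVandermondeCertificate a q M N j := by
  have hM : invQFac q (M - j) = (1 - q ^ (M - j + 1 : ℤ)) * invQFac q (M + 1 - j) := by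
    rw [invQFac_eq_mul_invQFac_add_one hq, sub_add_eq_add_sub]
  have hN : invQFac q (N - (j + 1)) = (1 - q ^ (N - j : ℤ)) * invQFac q (N - j) := by
    rw [← sub_sub, invQFac_sub_one hq]
  have hfactor := ha j
  have hpoch := qPoch_ne_zero ha j
  simp only [qVandermondeCertificate, qVandermondeTerm, Nat.cast_add, Nat.cast_one, hN,
    add_sub_add_right_eq_sub, hM,
    invQFac_natCast_eq_mul_succ hq j, qPoch_succ]
  simp only [zpow_sub₀ hq0, zpow_add₀ hq0, zpow_natCast, zpow_one]
  field_simp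
  ring

/-- The `q`-Chu–Vandermonde sum, in the form
`₂φ₁(q^{-M}, q^{-N}; a q; q, a q^{M + N + 1}) = (a q^{N + 1}; q)_M / (a q; q)_M`. -/
theorem sum_qVandermondeTerm (hq : ‖q‖ < 1) (hq0 : q ≠ 0) (ha : ∀ n, 1 - a * q * q ^ n ≠ 0)
    {M N T : ℕ} (hT : min M N ≤ T) :
    ∑ j ∈ Finset.range (T + 1), qVandermondeTerm a q M N j
      = qPoch (a * q) q (M + N) * ((qPoch (a * q) q M)⁻¹ * invQFac q M)
        * ((qPoch (a * q) q N)⁻¹ * invQFac q N) := by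
  induction M with
  | zero =>
    have hpoch := qPoch_ne_zero ha N
    rw [Finset.sum_eq_single 0
      (fun j _ hj => qVandermondeTerm_of_lt a q (by lia)) (by simp)]
    simp [qVandermondeTerm, invQFac_zero, qPoch_zero, hpoch]
  | succ M ih =>
    have hsum : (1 - q ^ (M + 1)) * (1 - a * q ^ (M + 1))
          * ∑ j ∈ Finset.range (T + 1), qVandermondeTerm a q (M + 1) N j
        - (1 - a * q ^ (M + N + 1)) * ∑ j ∈ Finset.range (T + 1), qVandermondeTerm a q M N j
        = 0 := by
      rw [Finset.mul_sum, Finset.mul_sum, ← Finset.sum_sub_distrib,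
        Finset.sum_congr rfl fun j _ => qVandermondeTerm_recurrence hq hq0 ha M N j,
        Finset.sum_range_sub]
      simp [qVandermondeCertificate,
        qVandermondeTerm_of_lt a q (show min (M + 1) N < T + 1 by lia)]
    have hfactor : 1 - a * q ^ (M + 1) ≠ 0 := by simpa [pow_succ', mul_assoc] using ha M
    have hqpow : 1 - q ^ (M + 1) ≠ 0 := one_sub_pow_ne_zero hq M.succ_ne_zero
    have hpoch := qPoch_ne_zero ha M
    rw [ih (by lia), invQFac_natCast_eq_mul_succ hq M] at hsum
    refine mul_left_cancel₀ (mul_ne_zero hqpow hfactor) ((sub_eq_zero.mp hsum).trans ?_)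
    rw [Nat.cast_succ, add_right_comm M 1 N, qPoch_succ, qPoch_succ, mul_assoc a, mul_assoc a,
      ← pow_succ', ← pow_succ']
    field_simp

/-- Let `N → ∞` in `sum_qVandermondeTerm`. -/
theorem sum_pow_mul_inv_qPoch_mul_invQFac (hq : ‖q‖ < 1) (hq0 : q ≠ 0)
    (ha : ∀ n, 1 - a * q * q ^ n ≠ 0) (M : ℕ) :
    ∑ j ∈ Finset.range (M + 1),
        a ^ j * q ^ j ^ 2 * ((qPoch (a * q) q j)⁻¹ * invQFac q j) * invQFac q (M - j)
      = (qPoch (a * q) q M)⁻¹ * invQFac q M := by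
  have hne := qPochInf_self_ne_zero hq
  have hane := qPochInf_ne_zero hq ha
  have hleft := tendsto_finsetSum (Finset.range (M + 1)) fun j _ =>
    ((tendsto_invQFac_natCast_sub hq j).const_mul (invQFac q (M - j))).const_mul
      (a ^ j * q ^ j ^ 2 * ((qPoch (a * q) q j)⁻¹ * invQFac q j))
  have hright := (((tendsto_qPoch (a * q) hq).comp (tendsto_add_atTop_nat M)).mul_const
    ((qPoch (a * q) q M)⁻¹ * invQFac q M)).mul
      (((tendsto_qPoch (a * q) hq).inv₀ hane).mul (tendsto_invQFac_natCast_add hq 0))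
  have hlim := tendsto_nhds_unique hleft <| hright.congr fun N => by
    simpa [qVandermondeTerm, add_comm] using
      (sum_qVandermondeTerm hq hq0 ha (min_le_left M N)).symm
  simp only [← mul_assoc, ← Finset.sum_mul] at hlim
  field_simp at hlim ⊢
  exact hlim

end

/-! ### Bailey pairs -/

section

variable {q : ℂ}

/-- A Bailey pair in base `q` relative to `a = q ^ s`, in bilateral form: when `s ≤ 1`, adding the
terms of index `k` and `-k - s` gives, up to the factor `(q; q)_s`, the usual
`β n = ∑_{r ≤ n} α_r / ((q; q)_{n-r} (a q; q)_{n+r})`. -/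
def IsBaileyPair (q : ℂ) (s : ℕ) (α : ℤ → ℂ) (β : ℕ → ℂ) : Prop :=
  ∀ n : ℕ, HasSum (fun k : ℤ => α k * (invQFac q (n - k) * invQFac q (n + k + s))) (β n)

/-- The second member of the Bailey pair in base `q ^ 2` to which the change of base `q → q ^ 2`
takes a Bailey pair in base `q` with second member `β`. -/
noncomputable def baseChange (q : ℂ) (s : ℕ) (β : ℕ → ℂ) (n : ℕ) : ℂ :=
  (qPoch (-q) q (2 * n + s))⁻¹
    * ∑ p ∈ antidiagonal n, (-1) ^ p.1 * q ^ p.1 ^ 2 * invQFac (q ^ 2) p.1 * β p.2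

theorem sum_antidiagonal_mul_invQFac_mul_invQFac (hq : ‖q‖ < 1) (hq0 : q ≠ 0) {M N : ℤ} {n : ℕ}
    (hn : min M N ≤ n) :
    ∑ p ∈ antidiagonal n, (-1) ^ p.1 * q ^ p.1 ^ 2 * invQFac (q ^ 2) p.1
        * (invQFac q (M - p.1) * invQFac q (N - p.1))
      = qPoch (-q) q (M + N).toNat * (invQFac (q ^ 2) M * invQFac (q ^ 2) N) := by
  rcases lt_or_ge M 0 with hM | hM
  · rw [invQFac_of_neg _ hM, zero_mul, mul_zero]
    exact Finset.sum_eq_zero fun p _ => by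
      rw [invQFac_of_neg q (n := M - p.1) (by lia), zero_mul, mul_zero]
  rcases lt_or_ge N 0 with hN | hN
  · rw [invQFac_of_neg _ hN, mul_zero, mul_zero]
    exact Finset.sum_eq_zero fun p _ => by
      rw [invQFac_of_neg q (n := N - p.1) (by lia), mul_zero, mul_zero]
  obtain ⟨M, rfl⟩ := Int.eq_ofNat_of_zero_le hM
  obtain ⟨N, rfl⟩ := Int.eq_ofNat_of_zero_le hN
  have hne : ∀ n, 1 - -q * q ^ n ≠ 0 := one_sub_mul_pow_ne_zero (by rwa [norm_neg]) hq
  have hsq : ∀ j : ℕ, invQFac (q ^ 2) j = (qPoch (-q) q j)⁻¹ * invQFac q j := fun j => by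
    rw [← qPoch_neg_mul_invQFac_sq hq, inv_mul_cancel_left₀ (qPoch_ne_zero hne j)]
  have hsum := sum_qVandermondeTerm (a := -1) (M := M) (N := N) (T := n) hq hq0
    (by simpa only [neg_one_mul] using hne) (by lia)
  simp only [qVandermondeTerm, neg_one_mul, ← hsq] at hsum
  rw [Finset.Nat.sum_antidiagonal_eq_sum_range_succ_mk, hsum, ← Nat.cast_add, Int.toNat_natCast,
    mul_assoc]

theorem sum_pow_mul_invQFac_mul_invQFac_natCast (hq : ‖q‖ < 1) (hq0 : q ≠ 0) (s N k : ℕ) :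
    ∑ L ∈ Finset.range (N + 1), q ^ (L ^ 2 + s * L) * invQFac q (N - L)
        * (invQFac q (L - k) * invQFac q (L + k + s))
      = q ^ (k ^ 2 + s * k) * (invQFac q (N - k) * invQFac q (N + k + s)) := by
  have hzero : ∀ L : ℕ, L < k → q ^ (L ^ 2 + s * L) * invQFac q (N - L)
      * (invQFac q (L - k) * invQFac q (L + k + s)) = 0 := fun L hL => by
    rw [invQFac_of_neg q (n := L - k) (by lia), zero_mul, mul_zero]
  rcases lt_or_ge N k with hNk | hkN
  · rw [invQFac_of_neg q (n := N - k) (by lia), zero_mul, mul_zero]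
    exact Finset.sum_eq_zero fun L hL => hzero L ((Finset.mem_range_succ_iff.mp hL).trans_lt hNk)
  obtain ⟨n, rfl⟩ := Nat.exists_eq_add_of_le hkN
  have hfac : ∀ m : ℕ, invQFac q ((k + m : ℕ) + k + s)
      = invQFac q (2 * k + s : ℕ) * (qPoch (q ^ (2 * k + s) * q) q m)⁻¹ := fun m => by
    rw [← invQFac_natCast_add]
    congr 1
    push_cast
    ring
  have hsum := sum_pow_mul_inv_qPoch_mul_invQFac (a := q ^ (2 * k + s)) hq hq0
    (fun n => by simpa only [← pow_succ, ← pow_add] using one_sub_pow_ne_zero hq (by lia)) n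
  rw [add_assoc, Finset.sum_range_add,
    Finset.sum_eq_zero fun L hL => hzero L (Finset.mem_range.mp hL), zero_add]
  have hn : ((k + n : ℕ) - k : ℤ) = n := by push_cast; ring
  trans q ^ (k ^ 2 + s * k) * invQFac q (2 * k + s : ℕ)
      * ((qPoch (q ^ (2 * k + s) * q) q n)⁻¹ * invQFac q n)
  · rw [← hsum, Finset.mul_sum]
    refine Finset.sum_congr rfl fun i _ => ?_
    rw [hfac, show ((k + i : ℕ) - k : ℤ) = i by push_cast; ring,
      show ((k + n : ℕ) - (k + i : ℕ) : ℤ) = n - i by push_cast; ring]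
    ring
  · rw [hfac, hn]
    ring

theorem sum_pow_mul_invQFac_mul_invQFac (hq : ‖q‖ < 1) (hq0 : q ≠ 0) {s : ℕ} (hs : s ≤ 1) (N : ℕ)
    (k : ℤ) :
    ∑ L ∈ Finset.range (N + 1), q ^ (L ^ 2 + s * L) * invQFac q (N - L)
        * (invQFac q (L - k) * invQFac q (L + k + s))
      = q ^ (k ^ 2 + s * k) * (invQFac q (N - k) * invQFac q (N + k + s)) := by
  rcases le_or_gt 0 k with hk | hk
  · obtain ⟨k, rfl⟩ := Int.eq_ofNat_of_zero_le hk
    exact_mod_cast sum_pow_mul_invQFac_mul_invQFac_natCast hq hq0 s N k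
  · obtain ⟨m, rfl⟩ : ∃ m : ℕ, k = -m - s := ⟨(-k - s).toNat, by lia⟩
    have hsub : ∀ L : ℕ, (L - (-m - s) : ℤ) = L + m + s := fun L => by ring
    have hadd : ∀ L : ℕ, (L + (-m - s) + s : ℤ) = L - m := fun L => by ring
    have hexp : ((-m - s : ℤ) ^ 2 + s * (-m - s)) = (m ^ 2 + s * m : ℕ) := by push_cast; ring
    simp only [hsub, hadd, hexp, zpow_natCast, mul_comm (invQFac q (_ + _ + _))]
    exact sum_pow_mul_invQFac_mul_invQFac_natCast hq hq0 s N m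

theorem norm_zpow_sq_add_mul_le_one (hq : ‖q‖ < 1) {s : ℕ} (hs : s ≤ 1) (k : ℤ) :
    ‖q ^ (k ^ 2 + s * k)‖ ≤ 1 := by
  have hnonneg : 0 ≤ k ^ 2 + s * k := by
    rw [sq, ← add_mul]
    rcases le_or_gt 0 k with hk | hk
    · positivity
    · exact mul_nonneg_of_nonpos_of_nonpos (by lia) hk.le
  obtain ⟨m, hm⟩ := Int.eq_ofNat_of_zero_le hnonneg
  rw [hm, zpow_natCast, norm_pow]
  exact pow_le_one₀ (norm_nonneg q) hq.le

theorem summable_norm_pow_sq_add_mul (hq : ‖q‖ < 1) (s : ℕ) {β : ℕ → ℂ} {C : ℝ}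
    (hβ : ∀ n, ‖β n‖ ≤ C) : Summable fun n => ‖q ^ (n ^ 2 + s * n) * β n‖ := by
  refine .of_nonneg_of_le (fun _ => norm_nonneg _) (fun n => ?_)
    ((summable_geometric_of_lt_one (norm_nonneg q) hq).mul_right C)
  rw [norm_mul, norm_pow]
  gcongr ?_ * ?_
  · exact pow_le_pow_of_le_one (norm_nonneg q) hq.le
      (Nat.le_add_right_of_le (Nat.le_self_pow two_ne_zero n))
  · exact hβ n

namespace IsBaileyPair

variable {s : ℕ} {α : ℤ → ℂ} {β : ℕ → ℂ}

theorem hasSum_sum {ι : Type*} (h : IsBaileyPair q s α β) (S : Finset ι) (c : ι → ℂ) (m : ι → ℕ) :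
    HasSum (fun k => α k * ∑ i ∈ S, c i * (invQFac q (m i - k) * invQFac q (m i + k + s)))
      (∑ i ∈ S, c i * β (m i)) := by
  refine (_root_.hasSum_sum fun i _ => (h (m i)).mul_left (c i)).congr_fun fun k => ?_
  rw [Finset.mul_sum]
  exact Finset.sum_congr rfl fun i _ => mul_left_comm _ _ _

protected theorem baseChange (h : IsBaileyPair q s α β) (hq : ‖q‖ < 1) (hq0 : q ≠ 0)
    (hs : s ≤ 1) : IsBaileyPair (q ^ 2) s α (baseChange q s β) := by
  intro n
  have hne : qPoch (-q) q (2 * n + s) ≠ 0 :=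
    qPoch_ne_zero (one_sub_mul_pow_ne_zero (by rwa [norm_neg]) hq) _
  refine ((h.hasSum_sum (antidiagonal n)
    (fun p => (-1) ^ p.1 * q ^ p.1 ^ 2 * invQFac (q ^ 2) p.1) Prod.snd).mul_left
      (qPoch (-q) q (2 * n + s))⁻¹).congr_fun fun k => ?_
  have hkernel := sum_antidiagonal_mul_invQFac_mul_invQFac (M := n - k) (N := n + k + s) (n := n)
    hq hq0 (by lia)
  rw [show (n - k + (n + k + s) : ℤ).toNat = 2 * n + s by lia] at hkernel
  rw [(eq_inv_mul_iff_mul_eq₀ hne).mpr hkernel.symm, mul_left_comm]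
  congr 2
  refine Finset.sum_congr rfl fun p hp => ?_
  have hp' : (n : ℤ) = p.1 + p.2 := by exact_mod_cast (mem_antidiagonal.mp hp).symm
  rw [hp', show (p.1 + p.2 - k - p.1 : ℤ) = p.2 - k by ring,
    show (p.1 + p.2 + k + s - p.1 : ℤ) = p.2 + k + s by ring]

/-- Bailey's lemma with both free parameters sent to infinity. -/
theorem step (h : IsBaileyPair q s α β) (hq : ‖q‖ < 1) (hq0 : q ≠ 0) (hs : s ≤ 1) :
    IsBaileyPair q s (fun k => α k * q ^ (k ^ 2 + s * k))
      (fun N => ∑ L ∈ Finset.range (N + 1), q ^ (L ^ 2 + s * L) * invQFac q (N - L) * β L) := by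
  intro N
  simp only [mul_assoc (α _), ← sum_pow_mul_invQFac_mul_invQFac hq hq0 hs]
  exact h.hasSum_sum _ (fun L : ℕ => q ^ (L ^ 2 + s * L) * invQFac q (N - L)) id

theorem tendsto (h : IsBaileyPair q s α β) (hq : ‖q‖ < 1) (hα : Summable fun k => ‖α k‖) :
    Tendsto β atTop (𝓝 ((∑' k, α k) * ((qPochInf q q)⁻¹ * (qPochInf q q)⁻¹))) := by
  obtain ⟨C, hC⟩ := exists_norm_invQFac_le hq
  rw [← tsum_mul_right, funext fun n => (h n).tsum_eq.symm]
  refine tendsto_tsum_of_dominated_convergence (hα.mul_right (C * C)) (fun k => ?_)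
    (Eventually.of_forall fun n k => ?_)
  · simp only [add_assoc]
    exact ((tendsto_invQFac_natCast_sub hq k).mul (tendsto_invQFac_natCast_add hq _)).const_mul _
  · rw [norm_mul, norm_mul]
    gcongr
    exacts [(norm_nonneg _).trans (hC 0), hC _, hC _]

theorem exists_norm_le (h : IsBaileyPair q s α β) (hq : ‖q‖ < 1) (hα : Summable fun k => ‖α k‖) :
    ∃ C, ∀ n, ‖β n‖ ≤ C :=
  exists_norm_le_of_tendsto (h.tendsto hq hα)

theorem hasSum_pow_mul (h : IsBaileyPair q s α β) (hq : ‖q‖ < 1) (hq0 : q ≠ 0) (hs : s ≤ 1)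
    (hα : Summable fun k => ‖α k‖) :
    HasSum (fun n => q ^ (n ^ 2 + s * n) * β n)
      ((∑' k : ℤ, α k * q ^ (k ^ 2 + s * k)) / qPochInf q q) := by
  obtain ⟨C, hC⟩ := h.exists_norm_le hq hα
  obtain ⟨D, hD⟩ := exists_norm_invQFac_le hq
  have hβ := summable_norm_pow_sq_add_mul hq s hC
  have hα' : Summable fun k : ℤ => ‖α k * q ^ (k ^ 2 + s * k)‖ := by
    refine .of_nonneg_of_le (fun _ => norm_nonneg _) (fun k => ?_) hα
    rw [norm_mul]
    exact mul_le_of_le_one_right (norm_nonneg _) (norm_zpow_sq_add_mul_le_one hq hs k)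
  have hsum : ∀ N : ℕ, ∑ L ∈ Finset.range (N + 1), q ^ (L ^ 2 + s * L) * invQFac q (N - L) * β L
      = ∑' L : ℕ, q ^ (L ^ 2 + s * L) * β L * invQFac q (N - L) := fun N => by
    rw [tsum_eq_sum (s := Finset.range (N + 1)) fun L hL => ?_]
    · exact Finset.sum_congr rfl fun L _ => mul_right_comm _ _ _
    · rw [invQFac_of_neg q (by rw [Finset.mem_range] at hL; lia), mul_zero]
  have hleft : Tendsto (fun N : ℕ => ∑' L : ℕ, q ^ (L ^ 2 + s * L) * β L * invQFac q (N - L)) atTop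
      (𝓝 ((∑' L, q ^ (L ^ 2 + s * L) * β L) * (qPochInf q q)⁻¹)) := by
    rw [← tsum_mul_right]
    refine tendsto_tsum_of_dominated_convergence (hβ.mul_right D)
      (fun L => (tendsto_invQFac_natCast_sub hq L).const_mul _)
      (Eventually.of_forall fun N L => ?_)
    rw [norm_mul]
    exact mul_le_mul_of_nonneg_left (hD _) (norm_nonneg _)
  have hne := qPochInf_self_ne_zero hq
  have hlim := tendsto_nhds_unique (hleft.congr fun N => (hsum N).symm)
    ((h.step hq hq0 hs).tendsto hq hα')
  rw [← mul_assoc] at hlim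
  rw [div_eq_mul_inv, ← mul_right_cancel₀ (inv_ne_zero hne) hlim]
  exact hβ.of_norm.hasSum

end IsBaileyPair

end

theorem hasSum_of_hasSum_sum_antidiagonal {A E : Type*} [AddMonoid A] [Finset.HasAntidiagonal A]
    [AddCommMonoid E] [TopologicalSpace E] [ContinuousAdd E] [T3Space E] {F : A × A → E} {S : E}
    (hF : Summable F) (h : HasSum (fun n => ∑ p ∈ antidiagonal n, F p) S) : HasSum F S := by
  have hsigma := (Finset.HasAntidiagonal.sigmaAntidiagonalEquivProd.hasSum_iff.mpr
    hF.hasSum).sigma fun n => hasSum_fintype _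
  have hS : S = ∑' p, F p := h.unique <| hsigma.congr_fun fun n =>
    (Finset.sum_coe_sort (antidiagonal n) F).symm
  exact hS ▸ hF.hasSum

section

variable {q : ℂ}

theorem IsBaileyPair.hasSum_double {s : ℕ} {α : ℤ → ℂ} {β : ℕ → ℂ} (h : IsBaileyPair q s α β)
    (hq : ‖q‖ < 1) (hq0 : q ≠ 0) (hs : s ≤ 1) (hα : Summable fun k => ‖α k‖) :
    HasSum (fun p : ℕ × ℕ => (q ^ 2) ^ ((p.1 + p.2) ^ 2 + s * (p.1 + p.2))
        * ((qPoch (-q) q (2 * (p.1 + p.2) + s))⁻¹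
          * ((-1) ^ p.1 * q ^ p.1 ^ 2 * invQFac (q ^ 2) p.1 * β p.2)))
      ((∑' k : ℤ, α k * (q ^ 2) ^ (k ^ 2 + s * k)) / qPochInf (q ^ 2) (q ^ 2)) := by
  have hq2 : ‖q ^ 2‖ < 1 := norm_pow_lt_one hq two_ne_zero
  refine hasSum_of_hasSum_sum_antidiagonal ?_ <|
    ((h.baseChange hq hq0 hs).hasSum_pow_mul hq2 (pow_ne_zero 2 hq0) hs hα).congr_fun fun n => ?_
  · obtain ⟨C, hC⟩ := exists_norm_inv_qPoch_le (a := -q) (by rwa [norm_neg]) hq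
    obtain ⟨D, hD⟩ := exists_norm_invQFac_le hq2
    obtain ⟨B, hB⟩ := h.exists_norm_le hq hα
    have hC0 : 0 ≤ C := (norm_nonneg _).trans (hC 0)
    have hD0 : 0 ≤ D := (norm_nonneg _).trans (hD 0)
    have hgeom := summable_geometric_of_lt_one (norm_nonneg q) hq
    refine .of_norm_bounded ((hgeom.mul_of_nonneg hgeom (fun _ => by positivity)
      fun _ => by positivity).mul_right (C * (1 * 1 * D * B))) fun p => ?_
    simp only [norm_mul, norm_pow, norm_neg, norm_one, one_pow, ← pow_mul, ← pow_add]
    gcongr ?_ * (?_ * (1 * ?_ * ?_ * ?_))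
    · exact pow_le_pow_of_le_one (norm_nonneg q) hq.le
        (by nlinarith [Nat.le_self_pow two_ne_zero (p.1 + p.2)])
    · exact hC _
    · exact pow_le_one₀ (norm_nonneg q) hq.le
    · exact hD _
    · exact hB _
  · rw [baseChange, Finset.mul_sum, Finset.mul_sum]
    refine Finset.sum_congr rfl fun p hp => ?_
    rw [mem_antidiagonal.mp hp]

end

/-! ### The triple product identity -/

section

variable {q z : ℂ}

/-- The `k`-th term `(-1)^k z^k q^{k(k-1)/2}` of Jacobi's theta series. -/
noncomputable def thetaTerm (z q : ℂ) (k : ℤ) : ℂ :=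
  (-z) ^ k * q ^ (k * (k - 1) / 2)

theorem thetaTerm_ne_zero (hz : z ≠ 0) (hq0 : q ≠ 0) (k : ℤ) : thetaTerm z q k ≠ 0 :=
  mul_ne_zero (zpow_ne_zero _ (neg_ne_zero.mpr hz)) (zpow_ne_zero _ hq0)

theorem thetaTerm_add_one (hz : z ≠ 0) (hq0 : q ≠ 0) (k : ℤ) :
    thetaTerm z q (k + 1) = -(z * q ^ k) * thetaTerm z q k := by
  have hexp : (k + 1) * (k + 1 - 1) / 2 = k * (k - 1) / 2 + k := by
    rw [← Int.add_mul_ediv_right _ _ two_ne_zero]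
    ring_nf
  rw [thetaTerm, thetaTerm, hexp, zpow_add_one₀ (neg_ne_zero.mpr hz), zpow_add₀ hq0]
  ring

theorem thetaTerm_neg (hq0 : q ≠ 0) (z : ℂ) (k : ℤ) :
    thetaTerm z q (-k) = thetaTerm (q / z) q k := by
  have hexp : -k * (-k - 1) / 2 = k * (k - 1) / 2 + k := by
    rw [← Int.add_mul_ediv_left _ _ two_ne_zero]
    congr 1
    ring
  rw [thetaTerm, thetaTerm, hexp, zpow_add₀ hq0, zpow_neg, ← inv_zpow, mul_left_comm, ← mul_zpow,
    mul_comm, inv_neg, neg_mul, div_eq_inv_mul]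

theorem thetaTerm_mul_pow (hq0 : q ≠ 0) (z : ℂ) (s : ℕ) (k : ℤ) :
    thetaTerm z q k * (q ^ 4) ^ (k ^ 2 + s * k) = thetaTerm (z * q ^ (4 * s + 4)) (q ^ 9) k := by
  obtain ⟨m, hm⟩ := (Int.even_mul_pred_self k).two_dvd
  have hdiv : k * (k - 1) / 2 = m := by lia
  have hexp : m + 4 * (k ^ 2 + s * k) = (4 * s + 4) * k + 9 * m := by linear_combination 4 * hm
  rw [thetaTerm, thetaTerm, hdiv, ← neg_mul, mul_zpow, mul_assoc, mul_assoc, ← zpow_natCast q,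
    ← zpow_natCast q, ← zpow_natCast q, ← zpow_mul, ← zpow_mul, ← zpow_mul, ← zpow_add₀ hq0,
    ← zpow_add₀ hq0]
  push_cast
  rw [hexp]

theorem summable_norm_thetaTerm_natCast (hz : z ≠ 0) (hq : ‖q‖ < 1) (hq0 : q ≠ 0) :
    Summable fun k : ℕ => ‖thetaTerm z q k‖ := by
  refine summable_of_ratio_test_tendsto_lt_one zero_lt_one
    (Eventually.of_forall fun k => norm_ne_zero_iff.mpr (thetaTerm_ne_zero hz hq0 k)) ?_
  have hratio : Tendsto (fun k : ℕ => ‖z‖ * ‖q‖ ^ k) atTop (𝓝 0) := by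
    simpa using (tendsto_pow_atTop_nhds_zero_of_lt_one (norm_nonneg q) hq).const_mul ‖z‖
  refine hratio.congr fun k => ?_
  rw [Nat.cast_succ, thetaTerm_add_one hz hq0]
  simp [thetaTerm_ne_zero hz hq0 k]

theorem summable_norm_thetaTerm (hz : z ≠ 0) (hq : ‖q‖ < 1) (hq0 : q ≠ 0) :
    Summable fun k => ‖thetaTerm z q k‖ :=
  .of_nat_of_neg (summable_norm_thetaTerm_natCast hz hq hq0) <| by
    simpa only [thetaTerm_neg hq0] using
      summable_norm_thetaTerm_natCast (div_ne_zero hq0 hz) hq hq0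

theorem hasSum_thetaTerm_mul_invQFac_succ (hz : z ≠ 0) (hq : ‖q‖ < 1) (hq0 : q ≠ 0) {A B : ℕ}
    {S : ℂ} (h : HasSum (fun k => thetaTerm z q k * (invQFac q (A - k) * invQFac q (B + k))) S) :
    HasSum (fun k => thetaTerm z q k * (invQFac q ((A + 1 : ℕ) - k) * invQFac q (B + k)))
      ((1 - q ^ (A + B + 1))⁻¹ * ((1 - z * q ^ A) * S)) := by
  have hne : 1 - q ^ (A + B + 1) ≠ 0 := one_sub_pow_ne_zero hq (A + B).succ_ne_zero
  have hshift : HasSum (fun k => thetaTerm z q k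
      * (q ^ (A + 1 - k : ℤ) * (invQFac q (A + 1 - k) * invQFac q (B + k - 1))))
      (-(z * q ^ A) * S) := by
    refine (Equiv.addRight (1 : ℤ)).hasSum_iff.mp <| (h.mul_left (-(z * q ^ A))).congr_fun
      fun k => ?_
    have hpow : q ^ k * q ^ (A - k : ℤ) = q ^ A := by
      rw [← zpow_add₀ hq0, add_sub_cancel, zpow_natCast]
    simp only [Function.comp_apply, Equiv.coe_addRight, thetaTerm_add_one hz hq0,
      add_sub_add_right_eq_sub, ← hpow, ← add_assoc, add_sub_cancel_right]
    ring
  have hsum := (h.add hshift).mul_left (1 - q ^ (A + B + 1))⁻¹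
  rw [show S + -(z * q ^ A) * S = (1 - z * q ^ A) * S by ring] at hsum
  refine hsum.congr_fun fun k => ?_
  have hA : invQFac q (A - k) = (1 - q ^ (A + 1 - k : ℤ)) * invQFac q (A + 1 - k) := by
    rw [← invQFac_sub_one hq, sub_right_comm, add_sub_cancel_right]
  have hpow : q ^ (A + 1 - k : ℤ) * q ^ (B + k : ℤ) = q ^ (A + B + 1) := by
    rw [← zpow_add₀ hq0, ← zpow_natCast]
    congr 1
    push_cast
    ring
  rw [eq_inv_mul_iff_mul_eq₀ hne, hA, invQFac_sub_one hq, Nat.cast_succ, ← hpow]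
  ring

theorem hasSum_thetaTerm_mul_invQFac_reflect (hq0 : q ≠ 0) {A B : ℕ} {S : ℂ}
    (h : HasSum (fun k => thetaTerm (q / z) q k * (invQFac q (A - k) * invQFac q (B + k))) S) :
    HasSum (fun k => thetaTerm z q k * (invQFac q (B - k) * invQFac q (A + k))) S := by
  refine (Equiv.neg ℤ).hasSum_iff.mp (h.congr_fun fun k => ?_)
  rw [Function.comp_apply, Equiv.neg_apply, thetaTerm_neg hq0, sub_neg_eq_add, ← sub_eq_add_neg,
    mul_comm (invQFac q (A - k))]

theorem hasSum_thetaTerm_mul_invQFac_of_zero (hz : z ≠ 0) (hq : ‖q‖ < 1) (hq0 : q ≠ 0) {B : ℕ}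
    {S : ℂ} (h : HasSum (fun k => thetaTerm z q k * (invQFac q (-k) * invQFac q (B + k)))
      (S * invQFac q B)) (A : ℕ) :
    HasSum (fun k => thetaTerm z q k * (invQFac q (A - k) * invQFac q (B + k)))
      (qPoch z q A * S * invQFac q (A + B : ℕ)) := by
  induction A with
  | zero => simpa [qPoch_zero] using h
  | succ A ih =>
    convert hasSum_thetaTerm_mul_invQFac_succ hz hq hq0 ih using 1
    have hne : 1 - q ^ (A + B + 1) ≠ 0 := one_sub_pow_ne_zero hq (A + B).succ_ne_zero
    rw [add_right_comm, invQFac_natCast_eq_mul_succ hq (A + B), Nat.cast_succ, qPoch_succ]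
    field_simp

/-- MacMahon's finite form of the triple product identity. -/
theorem hasSum_thetaTerm_mul_invQFac (hz : z ≠ 0) (hq : ‖q‖ < 1) (hq0 : q ≠ 0) (A B : ℕ) :
    HasSum (fun k => thetaTerm z q k * (invQFac q (A - k) * invQFac q (B + k)))
      (qPoch z q A * qPoch (q / z) q B * invQFac q (A + B : ℕ)) := by
  have hzero : HasSum (fun k => thetaTerm (q / z) q k * (invQFac q (-k) * invQFac q ((0 : ℕ) + k)))
      (1 * invQFac q (0 : ℕ)) := by
    convert hasSum_single (f := fun k => thetaTerm (q / z) q k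
      * (invQFac q (-k) * invQFac q ((0 : ℕ) + k))) 0 fun k hk => ?_ using 1
    · simp [thetaTerm, invQFac_zero]
    · rcases hk.lt_or_gt with hk | hk
      · rw [invQFac_of_neg q (n := (0 : ℕ) + k) (by lia), mul_zero, mul_zero]
      · rw [invQFac_of_neg q (n := -k) (by lia), zero_mul, mul_zero]
  refine hasSum_thetaTerm_mul_invQFac_of_zero hz hq hq0 ?_ A
  simpa using hasSum_thetaTerm_mul_invQFac_reflect hq0
    (hasSum_thetaTerm_mul_invQFac_of_zero (div_ne_zero hq0 hz) hq hq0 hzero B)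

/-- The second member of the Bailey pair whose first member is the theta series `thetaTerm z q`. -/
noncomputable def thetaPartner (z q : ℂ) (s n : ℕ) : ℂ :=
  qPoch z q n * qPoch (q / z) q (n + s) * invQFac q (2 * n + s : ℕ)

theorem isBaileyPair_theta (hz : z ≠ 0) (hq : ‖q‖ < 1) (hq0 : q ≠ 0) (s : ℕ) :
    IsBaileyPair q s (thetaTerm z q) (thetaPartner z q s) := fun n => by
  simpa only [thetaPartner, two_mul, add_assoc, Nat.cast_add, add_comm (s : ℤ)] using
    hasSum_thetaTerm_mul_invQFac hz hq hq0 n (n + s)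

/-- Jacobi's triple product identity. -/
theorem tsum_thetaTerm (hz : z ≠ 0) (hq : ‖q‖ < 1) (hq0 : q ≠ 0) :
    ∑' k, thetaTerm z q k = qPochInf₃ z (q / z) q q := by
  have hne := qPochInf_self_ne_zero hq
  have hpartner : Tendsto (thetaPartner z q 0) atTop
      (𝓝 (qPochInf z q * qPochInf (q / z) q * (qPochInf q q)⁻¹)) := by
    refine ((tendsto_qPoch z hq).mul (tendsto_qPoch (q / z) hq)).mul (tendsto_invQFac hq ?_)
    exact tendsto_natCast_atTop_atTop.comp (tendsto_id.const_mul_atTop' two_pos)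
  have hlim := tendsto_nhds_unique
    ((isBaileyPair_theta hz hq hq0 0).tendsto hq (summable_norm_thetaTerm hz hq hq0)) hpartner
  rw [qPochInf₃]
  field_simp at hlim
  rw [hlim]
  ring

end

/-! ### The double series -/

section

variable {q z : ℂ}

theorem hasSum_double_theta (hz : z ≠ 0) (hq : ‖q‖ < 1) (hq0 : q ≠ 0) {s : ℕ} (hs : s ≤ 1) :
    HasSum (fun p : ℕ × ℕ => (-1) ^ p.1
        * q ^ (6 * p.1 ^ 2 + 8 * p.1 * p.2 + 4 * p.2 ^ 2 + 4 * s * (p.1 + p.2))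
        * baseChange q s (thetaPartner z q s) p.2
        / (qPoch (-q ^ 2) (q ^ 2) (2 * p.1 + 2 * p.2 + s) * qPoch (q ^ 4) (q ^ 4) p.1))
      (qPochInf₃ (z * q ^ (4 * s + 4)) (q ^ 9 / (z * q ^ (4 * s + 4))) (q ^ 9) (q ^ 9)
        / qPochInf (q ^ 4) (q ^ 4)) := by
  have hdouble := ((isBaileyPair_theta hz hq hq0 s).baseChange hq hq0 hs).hasSum_double
    (norm_pow_lt_one hq two_ne_zero) (pow_ne_zero 2 hq0) hs (summable_norm_thetaTerm hz hq hq0)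
  have hq4 : (q ^ 2) ^ 2 = q ^ 4 := by ring
  simp only [hq4, thetaTerm_mul_pow hq0] at hdouble
  rw [tsum_thetaTerm (mul_ne_zero hz (pow_ne_zero _ hq0)) (norm_pow_lt_one hq (by simp))
    (pow_ne_zero 9 hq0)] at hdouble
  refine hdouble.congr_fun fun p => ?_
  rw [invQFac_natCast, mul_add 2 p.1]
  ring

theorem sum_antidiagonal_mul_of_succ_eq_zero {R : Type*} [NonUnitalNonAssocSemiring R] {u : ℕ → R}
    (hu : ∀ n, u (n + 1) = 0) (f : ℕ → R) (n : ℕ) :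
    ∑ p ∈ antidiagonal n, f p.1 * u p.2 = f n * u 0 := by
  cases n with
  | zero => simp
  | succ n => simp [Finset.Nat.sum_antidiagonal_succ', hu]

theorem baseChange_thetaPartner_one (hq : ‖q‖ < 1) (s n : ℕ) :
    baseChange q s (thetaPartner 1 q s) n
      = (-1) ^ n * q ^ n ^ 2 / (qPoch (q ^ 2) (q ^ 2) n * qPoch (-q) q (2 * n + s)) := by
  have hzero : thetaPartner 1 q s 0 = 1 := by
    have hne : qPoch q q s ≠ 0 := qPoch_ne_zero (one_sub_mul_pow_ne_zero hq hq) s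
    simp [thetaPartner, qPoch_zero, invQFac_natCast, hne]
  have hsucc : ∀ n, thetaPartner 1 q s (n + 1) = 0 := fun n => by
    rw [thetaPartner, qPoch_one_succ, zero_mul, zero_mul]
  rw [baseChange, sum_antidiagonal_mul_of_succ_eq_zero hsucc
    fun i => (-1) ^ i * q ^ i ^ 2 * invQFac (q ^ 2) i, hzero, invQFac_natCast]
  ring

theorem thetaPartner_inv_zero (hq : ‖q‖ < 1) {s : ℕ} (hs : s ≤ 1) :
    thetaPartner q⁻¹ q s 0 = 1 + s * q := by
  have hne : 1 - q ≠ 0 := by simpa using one_sub_pow_ne_zero hq one_ne_zero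
  interval_cases s
  · simp [thetaPartner, qPoch_zero, invQFac_zero]
  · simp only [thetaPartner, invQFac_natCast, mul_zero, qPoch_succ, qPoch_zero, div_inv_eq_mul]
    field_simp
    ring

theorem thetaPartner_inv_one (hq : ‖q‖ < 1) (hq0 : q ≠ 0) (s : ℕ) :
    thetaPartner q⁻¹ q s 1 = -q⁻¹ := by
  have hne : 1 - q ≠ 0 := by simpa using one_sub_pow_ne_zero hq one_ne_zero
  have hpoch : qPoch (q ^ 2) q (1 + s) ≠ 0 :=
    qPoch_ne_zero (one_sub_mul_pow_ne_zero (norm_pow_lt_one hq two_ne_zero) hq) _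
  have hsplit : qPoch q q (2 * 1 + s) = (1 - q) * qPoch (q ^ 2) q (1 + s) := by
    rw [show 2 * 1 + s = 1 + (1 + s) by ring, qPoch_add, pow_one, ← sq]
    simp [qPoch]
  rw [thetaPartner, invQFac_natCast, hsplit, div_inv_eq_mul, ← sq]
  rw [show qPoch q⁻¹ q 1 = 1 - q⁻¹ by simp [qPoch]]
  field_simp
  ring

theorem thetaPartner_inv_add_two (hq0 : q ≠ 0) (s n : ℕ) : thetaPartner q⁻¹ q s (n + 2) = 0 := by
  rw [thetaPartner, qPoch_inv_add_two hq0, zero_mul, zero_mul]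

theorem sum_antidiagonal_mul_thetaPartner_inv (hq : ‖q‖ < 1) (hq0 : q ≠ 0) {s : ℕ} (hs : s ≤ 1)
    (n : ℕ) :
    ∑ p ∈ antidiagonal n, (-1) ^ p.1 * q ^ p.1 ^ 2 * invQFac (q ^ 2) p.1
        * thetaPartner q⁻¹ q s p.2
      = (-1) ^ n * q ^ (n ^ 2 - 2 * n : ℤ) * invQFac (q ^ 2) n * (1 + s * q ^ (2 * n + 1)) := by
  cases n with
  | zero => simp [thetaPartner_inv_zero hq hs]
  | succ n =>
    have hexp : q ^ ((n + 1 : ℕ) ^ 2 - 2 * (n + 1 : ℕ) : ℤ) = q ^ n ^ 2 * q⁻¹ := by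
      rw [← zpow_natCast, ← zpow_sub_one₀ hq0]
      congr 1
      push_cast
      ring
    rw [Finset.Nat.sum_antidiagonal_succ', sum_antidiagonal_mul_of_succ_eq_zero
      (u := fun m => thetaPartner q⁻¹ q s (m + 1)) (fun m => thetaPartner_inv_add_two hq0 s m)
      fun i => (-1) ^ i * q ^ i ^ 2 * invQFac (q ^ 2) i]
    rw [thetaPartner_inv_zero hq hs, thetaPartner_inv_one hq hq0, hexp,
      invQFac_natCast_eq_mul_succ (norm_pow_lt_one hq two_ne_zero) n, Nat.cast_succ]
    field_simp
    ring

theorem baseChange_thetaPartner_inv (hq : ‖q‖ < 1) (hq0 : q ≠ 0) {s : ℕ} (hs : s ≤ 1) (n : ℕ) :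
    baseChange q s (thetaPartner q⁻¹ q s) n
      = (-1) ^ n * q ^ (n ^ 2 - 2 * n : ℤ) / (qPoch (q ^ 2) (q ^ 2) n * qPoch (-q) q (2 * n)) := by
  have hpoch : qPoch (-q) q (2 * n + s) = qPoch (-q) q (2 * n) * (1 + s * q ^ (2 * n + 1)) := by
    interval_cases s
    · simp
    · rw [qPoch_succ]
      push_cast
      ring
  have hne : qPoch (-q) q (2 * n + s) ≠ 0 :=
    qPoch_ne_zero (one_sub_mul_pow_ne_zero (by rwa [norm_neg]) hq) _
  have hfactor : 1 + s * q ^ (2 * n + 1) ≠ 0 := right_ne_zero_of_mul (hpoch ▸ hne)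
  rw [baseChange, sum_antidiagonal_mul_thetaPartner_inv hq hq0 hs, hpoch, invQFac_natCast]
  field_simp

theorem hasSum_mul_zero_pow_div {ι K : Type*} [DivisionRing K] [TopologicalSpace K] {E : ι → ℕ}
    {c d : ι → K} {i₀ : ι} {S : K} (hE : ∀ i ≠ i₀, E i ≠ 0) (hS : c i₀ * 0 ^ E i₀ / d i₀ = S) :
    HasSum (fun i => c i * 0 ^ E i / d i) S :=
  hS ▸ hasSum_single i₀ fun i hi => by rw [zero_pow (hE i hi), mul_zero, zero_div]

theorem hasSum_doubleSeries_one (hq : ‖q‖ < 1) {s t : ℕ} (hs : s ≤ 1) (ht : t + (4 * s + 4) = 9) :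
    HasSum (fun p : ℕ × ℕ => (-1 : ℂ) ^ (p.1 + p.2)
        * q ^ (6 * p.1 ^ 2 + 8 * p.1 * p.2 + 5 * p.2 ^ 2 + 4 * s * (p.1 + p.2))
        / (qPoch (-q ^ 2) (q ^ 2) (2 * p.1 + 2 * p.2 + s) * qPoch (q ^ 2) (q ^ 2) p.2
          * qPoch (-q) q (2 * p.2 + s) * qPoch (q ^ 4) (q ^ 4) p.1))
      (qPochInf₃ (q ^ (4 * s + 4)) (q ^ t) (q ^ 9) (q ^ 9) / qPochInf (q ^ 4) (q ^ 4)) := by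
  rcases eq_or_ne q 0 with rfl | hq0
  · refine hasSum_mul_zero_pow_div (i₀ := (0, 0)) (fun p hp => ?_) ?_
    · contrapose! hp
      ext <;> nlinarith
    · have ht0 : t ≠ 0 := by lia
      simp [qPoch, qPochInf, qPochInf₃, ht0]
  · have hdouble := hasSum_double_theta one_ne_zero hq hq0 hs
    have hdiv : q ^ 9 / q ^ (4 * s + 4) = q ^ t := by
      rw [← ht, pow_add, mul_div_cancel_right₀ _ (pow_ne_zero _ hq0)]
    rw [one_mul, hdiv] at hdouble
    refine hdouble.congr_fun fun p => ?_
    rw [baseChange_thetaPartner_one hq]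
    ring

theorem hasSum_doubleSeries_inv (hq : ‖q‖ < 1) {s t : ℕ} (hs : s ≤ 1) (ht : t + (4 * s + 3) = 9) :
    HasSum (fun p : ℕ × ℕ => (-1 : ℂ) ^ (p.1 + p.2)
        * q ^ (6 * p.1 ^ 2 + 8 * p.1 * p.2 + 5 * p.2 ^ 2 - 2 * p.2 + 4 * s * (p.1 + p.2))
        / (qPoch (-q ^ 2) (q ^ 2) (2 * p.1 + 2 * p.2 + s) * qPoch (q ^ 2) (q ^ 2) p.2
          * qPoch (-q) q (2 * p.2) * qPoch (q ^ 4) (q ^ 4) p.1))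
      (qPochInf₃ (q ^ (4 * s + 3)) (q ^ t) (q ^ 9) (q ^ 9) / qPochInf (q ^ 4) (q ^ 4)) := by
  rcases eq_or_ne q 0 with rfl | hq0
  · refine hasSum_mul_zero_pow_div (i₀ := (0, 0)) (fun p hp => ?_) ?_
    · contrapose! hp
      have hle : 6 * p.1 ^ 2 + 8 * p.1 * p.2 + 5 * p.2 ^ 2 ≤ 2 * p.2 := by lia
      ext <;> nlinarith [Nat.le_self_pow two_ne_zero p.1, Nat.le_self_pow two_ne_zero p.2]
    · have ht0 : t ≠ 0 := by lia
      simp [qPoch, qPochInf, qPochInf₃, ht0]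
  · have hdouble := hasSum_double_theta (inv_ne_zero hq0) hq hq0 hs
    have hmul : q⁻¹ * q ^ (4 * s + 4) = q ^ (4 * s + 3) := by
      rw [pow_succ' q (4 * s + 3), inv_mul_cancel_left₀ hq0]
    have hdiv : q ^ 9 / q ^ (4 * s + 3) = q ^ t := by
      rw [← ht, pow_add, mul_div_cancel_right₀ _ (pow_ne_zero _ hq0)]
    rw [hmul, hdiv] at hdouble
    refine hdouble.congr_fun fun p => ?_
    have hexp : q ^ (6 * p.1 ^ 2 + 8 * p.1 * p.2 + 5 * p.2 ^ 2 - 2 * p.2 + 4 * s * (p.1 + p.2))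
        = q ^ (6 * p.1 ^ 2 + 8 * p.1 * p.2 + 4 * p.2 ^ 2 + 4 * s * (p.1 + p.2))
          * q ^ (p.2 ^ 2 - 2 * p.2 : ℤ) := by
      have hle : 2 * p.2 ≤ 6 * p.1 ^ 2 + 8 * p.1 * p.2 + 5 * p.2 ^ 2 := by
        nlinarith [Nat.le_self_pow two_ne_zero p.2]
      rw [← zpow_natCast, ← zpow_natCast, ← zpow_add₀ hq0]
      congr 1
      push_cast [hle]
      ring
    rw [baseChange_thetaPartner_inv hq hq0 hs, hexp]
    ring

end

/-- Four Rogers–Ramanujan type identities for `|q| < 1`; each double series over `n, r ≥ 0`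
converges unconditionally to the stated quotient of infinite products.  In the third series the
exponent is a natural number since `2 r ≤ 5 r ^ 2`. -/
theorem mainTheorem6 (q : ℂ) (hq : ‖q‖ < 1) :
    HasSum
      (fun p : ℕ × ℕ =>
        (-1 : ℂ) ^ (p.1 + p.2)
            * q ^ (6 * p.1 ^ 2 + 8 * p.1 * p.2 + 5 * p.2 ^ 2 + 4 * p.1 + 4 * p.2)
          / (qPoch (-q ^ 2) (q ^ 2) (2 * p.1 + 2 * p.2 + 1) * qPoch (q ^ 2) (q ^ 2) p.2
              * qPoch (-q) q (2 * p.2 + 1) * qPoch (q ^ 4) (q ^ 4) p.1))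
      (qPochInf₃ q (q ^ 8) (q ^ 9) (q ^ 9) / qPochInf (q ^ 4) (q ^ 4))
    ∧ HasSum
      (fun p : ℕ × ℕ =>
        (-1 : ℂ) ^ (p.1 + p.2)
            * q ^ (6 * p.1 ^ 2 + 8 * p.1 * p.2 + 5 * p.2 ^ 2 + 4 * p.1 + 2 * p.2)
          / (qPoch (-q ^ 2) (q ^ 2) (2 * p.1 + 2 * p.2 + 1) * qPoch (q ^ 2) (q ^ 2) p.2
              * qPoch (-q) q (2 * p.2) * qPoch (q ^ 4) (q ^ 4) p.1))
      (qPochInf₃ (q ^ 2) (q ^ 7) (q ^ 9) (q ^ 9) / qPochInf (q ^ 4) (q ^ 4))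
    ∧ HasSum
      (fun p : ℕ × ℕ =>
        (-1 : ℂ) ^ (p.1 + p.2)
            * q ^ (6 * p.1 ^ 2 + 8 * p.1 * p.2 + 5 * p.2 ^ 2 - 2 * p.2)
          / (qPoch (-q ^ 2) (q ^ 2) (2 * p.1 + 2 * p.2) * qPoch (q ^ 2) (q ^ 2) p.2
              * qPoch (-q) q (2 * p.2) * qPoch (q ^ 4) (q ^ 4) p.1))
      (qPochInf (q ^ 3) (q ^ 3) / qPochInf (q ^ 4) (q ^ 4))
    ∧ HasSum
      (fun p : ℕ × ℕ =>
        (-1 : ℂ) ^ (p.1 + p.2)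
            * q ^ (6 * p.1 ^ 2 + 8 * p.1 * p.2 + 5 * p.2 ^ 2)
          / (qPoch (-q ^ 2) (q ^ 2) (2 * p.1 + 2 * p.2) * qPoch (q ^ 2) (q ^ 2) p.2
              * qPoch (-q) q (2 * p.2) * qPoch (q ^ 4) (q ^ 4) p.1))
      (qPochInf₃ (q ^ 4) (q ^ 5) (q ^ 9) (q ^ 9) / qPochInf (q ^ 4) (q ^ 4)) := by
  refine ⟨?_, ?_, ?_, ?_⟩
  · rw [qPochInf₃_swap]
    refine (pow_one q ▸ hasSum_doubleSeries_one hq le_rfl (t := 1) rfl).congr_fun fun p => ?_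
    ring_nf
  · rw [qPochInf₃_swap]
    refine (hasSum_doubleSeries_inv hq le_rfl (t := 2) rfl).congr_fun fun p => ?_
    have hle : p.2 ≤ p.2 ^ 2 := Nat.le_self_pow two_ne_zero p.2
    congr 3
    lia
  · rw [qPochInf_eq_qPochInf₃_pow_three (norm_pow_lt_one hq three_ne_zero), ← pow_mul, ← pow_mul]
    simpa using hasSum_doubleSeries_inv hq zero_le_one (t := 6) rfl
  · simpa using hasSum_doubleSeries_one hq zero_le_one (t := 5) rfl
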